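/- Let $F=\mathbf{F}_{128}$ be the field with $128$ elements, let $V=F^\times$ be the set of its $127$ nonzero elements, and let $$\mathrm{PG}(128)=\{\{a,b,c\} \mid a,b,c\in F^\times,\ a\neq b,\ a+b+c=0\}$$ be the projective Steiner triple system on $V$. For a permutation $T$ of $V$ let $\mathrm{PG}(128)^{T}=\{T(t)\mid t\in \mathrm{PG}(128)\}$, and let $\mathrm{PG}(128)\cup\mathrm{PG}(128)^{T}$ denote the abstract simplicial complex on $V$ generated by the triples in the two sets. Call $T$ a transversal to $\mathrm{PG}(128)$ if $\mathrm{PG}(128)$ and $\mathrm{PG}(128)^{T}$ are disjoint Steiner triple systems on $V$ (sets of $3$-element subsets such that any two distinct points of $V$ lie in exactly one of them) and $\mathrm{PG}(128)\cup\mathrm{PG}(128)^{T}$ is a (closed, connected) combinatorial surface with vertex set $V$, that is, a finite connected complex in which the link of every vertex is a cycle. **Theorem.** The map $P_7\colon x\mapsto x^7$ is a permutation of $V$ and a transversal to $\mathrm{PG}(128)$. The combinatorial surface $K=\mathrm{PG}(128)\cup \mathrm{PG}(128)^{P_7}$ is non-orientable of genus $2542$ (equivalently, of Euler characteristic $2-2542=-2540$);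 it has $127$ vertices and face vector $f=(f_0,f_1,f_2)=(127,8001,5334)$ (and no faces of dimension greater than $2$). Its $2$-chromatic number $\chi_2(K)$, the least number of colors in a coloring of the vertices of $K$ without monochromatic triangle, is $5$ or $6$. -/

import Mathlib

namespace PreAbstractSimplicialComplex

variable {V : Type*}

/-- The complex generated by a family `S` of finite sets: its faces are the nonempty subsets of
members of `S`. -/
def generated (S : Set (Finset V)) : PreAbstractSimplicialComplex V where
  faces := {s | s.Nonempty ∧ ∃ t ∈ S, s ⊆ t}
  isRelLowerSet_faces := by
    rintro s ⟨hs, t, ht, hst⟩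
    exact ⟨hs, fun u hu hne => ⟨hne, t, ht, hu.trans hst⟩⟩

/-- The vertices of `K`: the points whose singleton is a face. -/
def vertexSet (K : PreAbstractSimplicialComplex V) : Set V :=
  {v | {v} ∈ K}

/-- The number `f_i` of `i`-dimensional faces, that is, of faces with `i + 1` vertices. -/
noncomputable def faceCount (K : PreAbstractSimplicialComplex V) (i : ℕ) : ℕ :=
  {s : Finset V | s ∈ K ∧ s.card = i + 1}.ncard

/-- The Euler characteristic `f_0 - f_1 + f_2 - ⋯` of a complex on a finite vertex set. -/
noncomputable def eulerCharacteristic [Fintype V] (K : PreAbstractSimplicialComplex V) : ℤ :=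
  ∑ i ∈ Finset.range (Fintype.card V), (-1) ^ i * (K.faceCount i : ℤ)

/-- `K` is `(k, s)`-colorable: its vertices can be colored with `k` colors such that no face with
`s + 1` vertices is monochromatic. -/
def IsColorable (K : PreAbstractSimplicialComplex V) (k s : ℕ) : Prop :=
  ∃ c : K.vertexSet → Fin k, ∀ t ∈ K, t.card = s + 1 →
    ¬ ∃ i : Fin k, ∀ v : K.vertexSet, (v : V) ∈ t → c v = i

/-- The `s`-chromatic number of `K`: the least `k` such that `K` is `(k, s)`-colorable
(`⊤` if there is none). -/
noncomputable def chromaticNumber (K : PreAbstractSimplicialComplex V) (s : ℕ) : ℕ∞ :=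
  ⨅ k ∈ {k : ℕ | K.IsColorable k s}, (k : ℕ∞)

variable [DecidableEq V]

/-- The 1-skeleton of `K`, as a graph on the vertices of `K`. -/
def oneSkeleton (K : PreAbstractSimplicialComplex V) : SimpleGraph K.vertexSet where
  Adj u v := u ≠ v ∧ ({(u : V), (v : V)} : Finset V) ∈ K
  symm := ⟨fun u v h => ⟨h.1.symm, by rw [Finset.pair_comm]; exact h.2⟩⟩
  loopless := ⟨fun _ h => h.1 rfl⟩

/-- The link of `v` in `K`: the nonempty sets `s` with `v ∉ s` and `s ∪ {v} ∈ K`. -/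
def link (K : PreAbstractSimplicialComplex V) (v : V) : PreAbstractSimplicialComplex V where
  faces := {s | s.Nonempty ∧ v ∉ s ∧ insert v s ∈ K}
  isRelLowerSet_faces := by
    rintro s ⟨hs, hv, hK⟩
    refine ⟨hs, fun u hu hne => ⟨hne, fun h => hv (hu h), ?_⟩⟩
    exact (K.isRelLowerSet_faces hK).2 (Finset.insert_subset_insert v hu)
      (Finset.insert_nonempty v u)

/-- `K` is a triangulated circle: a 1-dimensional complex whose graph is a cycle of length
`n ≥ 3`. -/
def IsCycle (K : PreAbstractSimplicialComplex V) : Prop :=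
  (∀ s ∈ K, s.card ≤ 2) ∧ ∃ n : ℕ, 3 ≤ n ∧ Nonempty (K.oneSkeleton ≃g SimpleGraph.cycleGraph n)

/-- A (closed, connected) combinatorial surface: a finite connected complex in which the link of
every vertex is a triangulated circle. -/
structure IsCombinatorialSurface (K : PreAbstractSimplicialComplex V) : Prop where
  finite : K.faces.Finite
  connected : K.oneSkeleton.Connected
  link_isCycle : ∀ v ∈ K.vertexSet, (K.link v).IsCycle

/-- `a`, `b`, `c` are the three distinct vertices of a 2-face of `K`. -/
def IsTriangle (K : PreAbstractSimplicialComplex V) (a b c : V) : Prop :=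
  a ≠ b ∧ b ≠ c ∧ a ≠ c ∧ ({a, b, c} : Finset V) ∈ K

/-- The 2-faces of `K` can be coherently oriented. Here `o a b c` says that the cyclic order
`(a, b, c)` is the chosen orientation of the triangle `{a, b, c}`: each triangle gets exactly one
of its two cyclic orders, and two triangles with a common edge induce opposite directions on it. -/
def IsOrientable (K : PreAbstractSimplicialComplex V) : Prop :=
  ∃ o : V → V → V → Prop,
    (∀ a b c, o a b c → o b c a) ∧
    (∀ a b c, K.IsTriangle a b c → Xor (o a b c) (o b a c)) ∧
    (∀ a b c d, K.IsTriangle a b c → K.IsTriangle a b d → c ≠ d → (o a b c ↔ o b a d))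

/-- `K` is a non-orientable combinatorial surface of genus `g`, that is, with Euler
characteristic `2 - g`. -/
def IsNonorientableOfGenus [Fintype V] (K : PreAbstractSimplicialComplex V) (g : ℕ) : Prop :=
  K.IsCombinatorialSurface ∧ ¬ K.IsOrientable ∧ K.eulerCharacteristic = 2 - (g : ℤ)

end PreAbstractSimplicialComplex

namespace SteinerTriple

variable {V : Type*}

/-- `S` is (the set of triples of) a Steiner triple system on `V`: a set of 3-element subsets such
that any two distinct points lie in exactly one of them. -/
structure IsSteinerTripleSystem (S : Set (Finset V)) : Prop where
  card_eq : ∀ t ∈ S, t.card = 3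
  existsUnique : ∀ x y : V, x ≠ y → ∃! t : Finset V, t ∈ S ∧ x ∈ t ∧ y ∈ t

/-- The image `S ^ T` of a set of triples under a permutation `T`. -/
def image (S : Set (Finset V)) (T : Equiv.Perm V) : Set (Finset V) :=
  (fun t => t.map T.toEmbedding) '' S

/-- The simplicial complex `S ∪ S'` generated by two sets of triples. -/
def unionComplex (S S' : Set (Finset V)) : PreAbstractSimplicialComplex V :=
  PreAbstractSimplicialComplex.generated (S ∪ S')

/-- The pair `S`, `S'` is a Steiner surface on `V`: two disjoint Steiner triple systems whose union
is a combinatorial surface with vertex set `V`. -/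
structure IsSteinerSurface [DecidableEq V] (S S' : Set (Finset V)) : Prop where
  left : IsSteinerTripleSystem S
  right : IsSteinerTripleSystem S'
  disjoint : Disjoint S S'
  vertexSet_eq : (unionComplex S S').vertexSet = Set.univ
  isCombinatorialSurface : (unionComplex S S').IsCombinatorialSurface

/-- The permutation `T` is a transversal to `S`: the pair `S`, `S ^ T` is a Steiner surface. -/
def IsTransversal [DecidableEq V] (S : Set (Finset V)) (T : Equiv.Perm V) : Prop :=
  IsSteinerSurface S (image S T)

/-- The projective geometry Steiner triple system `PG(N)` on the nonzero elements of a field `F`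
with `N = 2 ^ d` elements: all triples `{a, b, c}` with `a ≠ b` and `a + b + c = 0`. -/
def PG (F : Type*) [Field F] [DecidableEq F] : Set (Finset Fˣ) :=
  {t | ∃ a b c : Fˣ, a ≠ b ∧ (a : F) + b + c = 0 ∧ t = {a, b, c}}

end SteinerTriple

/-!
Write `T` for the permutation `x ↦ x ^ 7` and `K` for the complex `PG(128) ∪ PG(128) ^ T`. The field
is generated by a root `u` of `X ^ 7 + X + 1`, and its units are the powers of `u`, with exponents
modulo 127. Three distinct units span a triangle of `K` when their sum vanishes (a projective
triple), or when the sum of their images under `x ↦ x ^ 109`, the inverse of `T`, vanishes (a triple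
of the image). Both conditions are homogeneous, so multiplication by units acts on `K`, transitively
on the vertices, and a single vertex link determines `K`.

The link of `1` is the graph in which `y` is joined to `y + 1` and to `T (T⁻¹ y + 1)`. It is a cycle
of length 126, given by the list of exponents `linkExponent`; that consecutive entries are adjacent
means that certain trinomials `1 + X ^ a + X ^ b` are divisible by `X ^ 7 + X + 1` over the field
with two elements, which is checked by division with remainder on binary digits
(`one_add_pow_add_pow_eq_zero`). Translation gives all links (`insert_linkPoint_mem_iff`), so `K` is
a surface. The two triple systems are disjoint because `x ^ 7 + y ^ 7 + (x + y) ^ 7` factors as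
`x * y * (x + y) * (x ^ 2 + x * y + y ^ 2) ^ 2` in characteristic two and 3 does not divide 127.
The face numbers, and with them the Euler characteristic, hold for any two disjoint Steiner triple
systems.

An orientation of `K` would orient all links, hence compare the orientation at `v` with that at
`v * u`. The links at the two ends of the edge `{v, v * u}` show that these orientations always
differ, which contradicts the odd order of `u` (`not_isOrientable`).

A coloring of the units without monochromatic projective triples yields an edge coloring of the
complete graph on the field without monochromatic triangles, so Ramsey's pigeonhole bound excludes 4
colors (`card_le_triangleBound`). In the other direction an explicit coloring with 6 colors is
checked on the triangles `{v, v * u ^ a, v * u ^ b}`, with `a`, `b` consecutive in the link cycle.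
-/

/-! ### Binary polynomials -/

/-- The value at `g` of the polynomial over the field with two elements whose coefficients are the
binary digits of a natural number. -/
noncomputable def evalBits {R : Type*} [CommRing R] (g : R) (n : ℕ) : R :=
  Nat.binaryRec (motive := fun _ => R) 0 (fun b _ y => (if b then 1 else 0) + g * y) n

/-- The remainder modulo `X ^ 7 + X + 1` (binary digits `131`) of the polynomial with binary digits
`n`, provided that its degree is less than `k + 7`. -/
def reduceBits : ℕ → ℕ → ℕ
  | 0, n => n
  | k + 1, n => reduceBits k (if n.testBit (k + 7) then n ^^^ (131 <<< k) else n)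

section EvalBits

variable {R : Type*} [CommRing R] (g : R)

lemma evalBits_zero : evalBits g 0 = 0 := by simp [evalBits]

lemma evalBits_bit (b : Bool) (n : ℕ) :
    evalBits g (Nat.bit b n) = (if b then 1 else 0) + g * evalBits g n := by
  unfold evalBits
  rw [Nat.binaryRec_eq]
  simp

lemma evalBits_xor [CharP R 2] (m n : ℕ) :
    evalBits g (m ^^^ n) = evalBits g m + evalBits g n := by
  induction m using Nat.binaryRec' generalizing n with
  | zero => simp [evalBits_zero]
  | bit b m _ ih =>
    obtain ⟨c, k, rfl⟩ : ∃ c k, n = Nat.bit c k := ⟨_, _, (Nat.bit_bodd_div2 n).symm⟩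
    rw [Nat.xor_bit, evalBits_bit, evalBits_bit, evalBits_bit, ih]
    have h2 : (1 : R) + 1 = 0 := CharTwo.add_self_eq_zero 1
    cases b <;> cases c <;> simp <;> first | ring1 | linear_combination -h2

lemma evalBits_shiftLeft (n k : ℕ) : evalBits g (n <<< k) = g ^ k * evalBits g n := by
  induction k with
  | zero => simp
  | succ k ih =>
    have h : n <<< (k + 1) = Nat.bit false (n <<< k) := by
      simp [Nat.shiftLeft_eq]; ring
    rw [h, evalBits_bit, ih]
    simp; ring

lemma evalBits_one : evalBits g 1 = 1 := by
  have := evalBits_bit g true 0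
  simpa [evalBits_zero] using this

lemma evalBits_two_pow (k : ℕ) : evalBits g (2 ^ k) = g ^ k := by
  have := evalBits_shiftLeft g 1 k
  simpa [evalBits_one, Nat.shiftLeft_eq] using this

lemma evalBits_modulus [CharP R 2] : evalBits g 131 = g ^ 7 + g + 1 := by
  have h : (131 : ℕ) = 2 ^ 7 ^^^ 2 ^ 1 ^^^ 2 ^ 0 := by decide
  rw [h, evalBits_xor, evalBits_xor, evalBits_two_pow, evalBits_two_pow, evalBits_two_pow]
  simp

variable {g}

lemma evalBits_reduceBits [CharP R 2] (hg : g ^ 7 + g + 1 = 0) (k n : ℕ) :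
    evalBits g (reduceBits k n) = evalBits g n := by
  induction k generalizing n with
  | zero => rfl
  | succ k ih =>
    rw [reduceBits, ih]
    split_ifs
    · rw [evalBits_xor, evalBits_shiftLeft, evalBits_modulus, hg, mul_zero, add_zero]
    · rfl

/-- Trinomials in a root of `X ^ 7 + X + 1` are shown to vanish by division with remainder. -/
lemma one_add_pow_add_pow_eq_zero [CharP R 2] (hg : g ^ 7 + g + 1 = 0) {a b : ℕ}
    (h : reduceBits 120 (1 ^^^ 2 ^ a ^^^ 2 ^ b) = 0) : 1 + g ^ a + g ^ b = 0 := by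
  rw [← evalBits_two_pow g a, ← evalBits_two_pow g b, ← evalBits_one g, ← evalBits_xor,
    ← evalBits_xor, ← evalBits_reduceBits hg 120, h, evalBits_zero]

end EvalBits

/-! ### The field with 128 elements -/

section Field128

variable {F : Type*} [Field F] [Fintype F]

lemma charP_two_of_card (hF : Fintype.card F = 128) : CharP F 2 := by
  obtain ⟨p, hp⟩ := CharP.exists F
  obtain ⟨n, hprime, hn⟩ := FiniteField.card F p
  have : p ∣ 2 ^ 7 := by
    rw [show (2 : ℕ) ^ 7 = 128 by norm_num, ← hF, hn]
    exact dvd_pow_self p n.ne_zero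
  have := (Nat.prime_dvd_prime_iff_eq hprime Nat.prime_two).1 (hprime.dvd_of_dvd_pow this)
  exact this ▸ hp

open Polynomial in
/-- Modulo `X ^ 7 + X + 1`, seven squarings return `X`; so this polynomial divides `X ^ 128 - X`,
which splits in a field with 128 elements. -/
lemma exists_root_of_card (hF : Fintype.card F = 128) : ∃ g : F, g ^ 7 + g + 1 = 0 := by
  have := charP_two_of_card hF
  set p : F[X] := X ^ 7 + X + 1 with hp
  have hdeg : p.degree = 7 := by rw [hp]; compute_degree!
  have hsplit : (X ^ Fintype.card F - X : F[X]).Splits := by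
    let _ : Algebra (ZMod 2) F := ZMod.algebra F 2
    simpa using FiniteField.splits_X_pow_card_sub_X (K := F) 2
  rw [hF] at hsplit
  have hdvd : p ∣ X ^ 128 - X := by
    have : CharP (AdjoinRoot p) 2 := charP_of_injective_algebraMap (R := F)
      (AdjoinRoot.of.injective_of_degree_ne_zero (by rw [hdeg]; norm_num)) 2
    set r := AdjoinRoot.root p
    have h2 : (2 : AdjoinRoot p) = 0 := CharTwo.two_eq_zero
    have h7 : r ^ 7 + r + 1 = 0 := by
      have := AdjoinRoot.mk_self (f := p)
      simpa [hp] using this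
    have h8 : r ^ 8 = r ^ 2 + r := by linear_combination r * h7 - (r ^ 2 + r) * h2
    have h16 : r ^ 16 = r ^ 4 + r ^ 2 := by
      rw [show r ^ 16 = (r ^ 8) ^ 2 by ring, h8, CharTwo.add_sq]; ring
    have h32 : r ^ 32 = r ^ 4 + r ^ 2 + r := by
      rw [show r ^ 32 = (r ^ 16) ^ 2 by ring, h16, CharTwo.add_sq]
      linear_combination h8
    have h64 : r ^ 64 = r ^ 4 + r := by
      rw [show r ^ 64 = (r ^ 32) ^ 2 by ring, h32, CharTwo.add_sq, CharTwo.add_sq]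
      linear_combination h8 + r ^ 2 * h2
    have h128 : r ^ 128 = r := by
      rw [show r ^ 128 = (r ^ 64) ^ 2 by ring, h64, CharTwo.add_sq]
      linear_combination h8 + r ^ 2 * h2
    rw [← AdjoinRoot.mk_eq_zero]
    simpa [sub_eq_zero] using h128
  have hne : (X ^ 128 - X : F[X]) ≠ 0 := FiniteField.X_pow_card_sub_X_ne_zero F (by norm_num)
  obtain ⟨g, hg⟩ := (hsplit.of_dvd hne hdvd).exists_eval_eq_zero (by rw [hdeg]; norm_num)
  exact ⟨g, by simpa [hp] using hg⟩

lemma unit_pow_eq_one (hF : Fintype.card F = 128) (x : Fˣ) : x ^ 127 = 1 := by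
  have : Nat.card Fˣ = 127 := by rw [Nat.card_units, Nat.card_eq_fintype_card, hF]
  rw [← this, pow_card_eq_one']

lemma nontrivial_units (hF : Fintype.card F = 128) : Nontrivial Fˣ :=
  Finite.one_lt_card_iff_nontrivial.1
    (by rw [Nat.card_units, Nat.card_eq_fintype_card, hF]; norm_num)

lemma exists_unit_root_of_card (hF : Fintype.card F = 128) :
    ∃ u : Fˣ, (u : F) ^ 7 + u + 1 = 0 := by
  obtain ⟨g, hg⟩ := exists_root_of_card hF
  have hg0 : g ≠ 0 := by
    rintro rfl
    simp at hg
  exact ⟨Units.mk0 g hg0, hg⟩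

lemma orderOf_unit_root (hF : Fintype.card F = 128) {u : Fˣ}
    (hu : (u : F) ^ 7 + u + 1 = 0) : orderOf u = 127 := by
  have := charP_two_of_card hF
  have : Fact (Nat.Prime 127) := ⟨by norm_num⟩
  refine orderOf_eq_prime (unit_pow_eq_one hF u) ?_
  rintro rfl
  exact one_ne_zero (α := F) (by
    simp only [Units.val_one, one_pow] at hu
    linear_combination hu - CharTwo.add_self_eq_zero (1 : F))

lemma exists_pow_unit_root_eq (hF : Fintype.card F = 128) {u : Fˣ}
    (hu : (u : F) ^ 7 + u + 1 = 0) (x : Fˣ) : ∃ n : ℕ, u ^ n = x := by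
  have : Fact (Nat.Prime 127) := ⟨by norm_num⟩
  have h1 : u ≠ 1 := by
    intro h
    have := orderOf_unit_root hF hu
    rw [h, orderOf_one] at this
    omega
  have hcard : Nat.card Fˣ = 127 := by
    rw [Nat.card_units, Nat.card_eq_fintype_card, hF]
  exact mem_powers_of_prime_card hcard h1

end Field128

/-! ### Complexes generated by two Steiner triple systems -/

namespace SteinerTriple

open PreAbstractSimplicialComplex

variable {V : Type*} {S S' : Set (Finset V)}

lemma IsSteinerTripleSystem.image (h : IsSteinerTripleSystem S) (T : Equiv.Perm V) :
    IsSteinerTripleSystem (image S T) where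
  card_eq := by
    rintro _ ⟨t, ht, rfl⟩
    simpa using h.card_eq t ht
  existsUnique x y hxy := by
    obtain ⟨t, ⟨ht, hx, hy⟩, huniq⟩ := h.existsUnique (T.symm x) (T.symm y) (by simpa using hxy)
    refine ⟨t.map T.toEmbedding, ⟨⟨t, ht, rfl⟩, ?_, ?_⟩, ?_⟩
    · rwa [Finset.mem_map_equiv]
    · rwa [Finset.mem_map_equiv]
    · rintro _ ⟨⟨u, hu, rfl⟩, hx', hy'⟩
      simp only [Finset.mem_map_equiv] at hx' hy'
      simp only
      rw [huniq u ⟨hu, hx', hy'⟩]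

/-- A Steiner triple system on `n` points has `n (n - 1) / 6` triples: each pair lies in exactly one
triple, and each triple contains three pairs. -/
lemma IsSteinerTripleSystem.three_mul_ncard [Fintype V] (h : IsSteinerTripleSystem S) :
    3 * S.ncard = (Fintype.card V).choose 2 := by
  classical
  have hfin : S.Finite := Set.toFinite S
  have key : (Finset.univ : Finset V).powersetCard 2 =
      hfin.toFinset.biUnion fun t => t.powersetCard 2 := by
    ext p
    simp only [Finset.mem_powersetCard, Finset.subset_univ, true_and, Finset.mem_biUnion,
      Set.Finite.mem_toFinset]
    refine ⟨fun hp => ?_, fun ⟨_, _, _, hp⟩ => hp⟩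
    obtain ⟨x, y, hxy, rfl⟩ := Finset.card_eq_two.1 hp
    obtain ⟨t, ⟨ht, hx, hy⟩, -⟩ := h.existsUnique x y hxy
    exact ⟨t, ht, by simp [Finset.insert_subset_iff, hx, hy], hp⟩
  have hcard := congrArg Finset.card key
  rw [Finset.card_powersetCard, Finset.card_univ, Finset.card_biUnion] at hcard
  · rw [hcard, Finset.sum_congr rfl (g := fun _ => 3), Finset.sum_const,
      Set.ncard_eq_toFinset_card S hfin, smul_eq_mul, mul_comm]
    intro t ht
    rw [Finset.card_powersetCard, h.card_eq t (by simpa using ht)]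
    rfl
  · intro t ht u hu htu
    rw [Function.onFun, Finset.disjoint_left]
    intro p hpt hpu
    rw [Finset.mem_powersetCard] at hpt hpu
    obtain ⟨x, y, hxy, rfl⟩ := Finset.card_eq_two.1 hpt.2
    simp only [Finset.insert_subset_iff, Finset.singleton_subset_iff] at hpt hpu
    exact htu ((h.existsUnique x y hxy).unique ⟨by simpa using ht, hpt.1⟩
      ⟨by simpa using hu, hpu.1⟩)

lemma pair_mem_unionComplex [DecidableEq V] (h : IsSteinerTripleSystem S) {x y : V} (hxy : x ≠ y) :
    ({x, y} : Finset V) ∈ unionComplex S S' := by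
  obtain ⟨t, ⟨ht, hx, hy⟩, -⟩ := h.existsUnique x y hxy
  exact ⟨by simp, t, Or.inl ht, by simp [Finset.insert_subset_iff, hx, hy]⟩

lemma singleton_mem_unionComplex [Nontrivial V] (h : IsSteinerTripleSystem S) (x : V) :
    ({x} : Finset V) ∈ unionComplex S S' := by
  obtain ⟨y, hy⟩ := exists_ne x
  obtain ⟨t, ⟨ht, hx, -⟩, -⟩ := h.existsUnique x y hy.symm
  exact ⟨by simp, t, Or.inl ht, by simpa using hx⟩

lemma vertexSet_unionComplex [Nontrivial V] (h : IsSteinerTripleSystem S) :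
    (unionComplex S S').vertexSet = Set.univ :=
  Set.eq_univ_of_forall fun x => singleton_mem_unionComplex h x

lemma card_le_three_of_mem_unionComplex (h : IsSteinerTripleSystem S)
    (h' : IsSteinerTripleSystem S') {s : Finset V} (hs : s ∈ unionComplex S S') :
    s.card ≤ 3 := by
  obtain ⟨-, t, ht, hst⟩ := hs
  exact (Finset.card_le_card hst).trans (ht.elim (h.card_eq t) (h'.card_eq t)).le

lemma mem_unionComplex_of_card_eq_three (h : IsSteinerTripleSystem S)
    (h' : IsSteinerTripleSystem S') {s : Finset V} (hs : s.card = 3) :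
    s ∈ unionComplex S S' ↔ s ∈ S ∪ S' := by
  refine ⟨fun ⟨_, t, ht, hst⟩ => ?_, fun hmem => ⟨?_, s, hmem, subset_rfl⟩⟩
  · have := ht.elim (h.card_eq t) (h'.card_eq t)
    rwa [Finset.eq_of_subset_of_card_le hst (by rw [hs, this])]
  · exact Finset.card_pos.1 (by omega)

lemma oneSkeleton_unionComplex_connected [DecidableEq V] [Nontrivial V]
    (h : IsSteinerTripleSystem S) :
    (unionComplex S S').oneSkeleton.Connected := by
  obtain ⟨x⟩ := (inferInstance : Nonempty V)
  have : Nonempty (unionComplex S S').vertexSet := ⟨⟨x, singleton_mem_unionComplex h x⟩⟩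
  refine ⟨fun u v => ?_⟩
  by_cases huv : u = v
  · exact huv ▸ SimpleGraph.Reachable.refl u
  · exact SimpleGraph.Adj.reachable
      ⟨huv, pair_mem_unionComplex h fun h' => huv (Subtype.ext h')⟩

lemma faceCount_unionComplex_of_three_le (h : IsSteinerTripleSystem S)
    (h' : IsSteinerTripleSystem S') {i : ℕ} (hi : 3 ≤ i) :
    (unionComplex S S').faceCount i = 0 := by
  have : {s : Finset V | s ∈ unionComplex S S' ∧ s.card = i + 1} = ∅ := by
    ext s
    simp only [Set.mem_ofPred_eq, Set.mem_empty_iff_false, iff_false, not_and]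
    intro hs
    have := card_le_three_of_mem_unionComplex h h' hs
    omega
  rw [faceCount, this, Set.ncard_empty]

section FaceCount

variable [Fintype V]

/-- If all sets of `k` vertices are faces, there are `choose n k` of them. -/
lemma faceCount_eq_choose {K : PreAbstractSimplicialComplex V} {i : ℕ}
    (hK : ∀ s : Finset V, s.card = i + 1 → s ∈ K) :
    K.faceCount i = (Fintype.card V).choose (i + 1) := by
  have : {s : Finset V | s ∈ K ∧ s.card = i + 1} =
      ((Finset.univ : Finset V).powersetCard (i + 1) : Set (Finset V)) := by
    ext s
    simpa using hK s
  rw [faceCount, this, Set.ncard_coe_finset, Finset.card_powersetCard, Finset.card_univ]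

lemma faceCount_zero_unionComplex [Nontrivial V] (h : IsSteinerTripleSystem S) :
    (unionComplex S S').faceCount 0 = Fintype.card V := by
  rw [faceCount_eq_choose, zero_add, Nat.choose_one_right]
  intro s hs
  obtain ⟨x, rfl⟩ := Finset.card_eq_one.1 hs
  exact singleton_mem_unionComplex h x

lemma faceCount_one_unionComplex (h : IsSteinerTripleSystem S) :
    (unionComplex S S').faceCount 1 = (Fintype.card V).choose 2 := by
  classical
  rw [faceCount_eq_choose]
  intro s hs
  obtain ⟨x, y, hxy, rfl⟩ := Finset.card_eq_two.1 hs
  exact pair_mem_unionComplex h hxy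

lemma faceCount_two_unionComplex (h : IsSteinerTripleSystem S) (h' : IsSteinerTripleSystem S')
    (hd : Disjoint S S') : 3 * (unionComplex S S').faceCount 2 = 2 * (Fintype.card V).choose 2 := by
  have : {s : Finset V | s ∈ unionComplex S S' ∧ s.card = 2 + 1} = S ∪ S' := by
    ext s
    refine ⟨fun hs => (mem_unionComplex_of_card_eq_three h h' hs.2).1 hs.1, fun hs => ?_⟩
    have hcard := hs.elim (h.card_eq s) (h'.card_eq s)
    exact ⟨(mem_unionComplex_of_card_eq_three h h' hcard).2 hs, hcard⟩
  rw [faceCount, this, Set.ncard_union_eq hd (Set.toFinite S) (Set.toFinite S')]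
  linarith [h.three_mul_ncard, h'.three_mul_ncard]

lemma eulerCharacteristic_unionComplex (h : IsSteinerTripleSystem S)
    (h' : IsSteinerTripleSystem S') (hV : 3 ≤ Fintype.card V) :
    (unionComplex S S').eulerCharacteristic = (unionComplex S S').faceCount 0 -
      (unionComplex S S').faceCount 1 + (unionComplex S S').faceCount 2 := by
  rw [eulerCharacteristic, ← Finset.sum_subset (Finset.range_subset_range.2 hV)]
  · simp [Finset.sum_range_succ]
    ring
  · intro i _ hi
    rw [faceCount_unionComplex_of_three_le h h' (by simpa using hi)]
    simp

end FaceCount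

end SteinerTriple

/-! ### Colorings without monochromatic Schur triples -/

section Schur

variable {G : Type*} [AddCommGroup G] [DecidableEq G]

/-- The recursive upper bound `1, 2, 5, 16, 65, …` for the largest complete graph whose edges can be
colored with `k` colors without a monochromatic triangle. -/
def triangleBound : ℕ → ℕ
  | 0 => 1
  | k + 1 => (k + 1) * triangleBound k + 1

/-- In an elementary abelian 2-group, color the edge `{x, y}` of the complete graph on the elements
by the color of `x + y`. If nonzero elements `a ≠ b` never have the same color as `a + b`, there is
no monochromatic triangle, and Ramsey's pigeonhole argument applies: the edges from a fixed vertex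
to its neighbors through edges of color `i` leave no edge of color `i` between the latter. -/
lemma card_le_triangleBound {k : ℕ} (hG : ∀ x : G, x + x = 0) (c : G → Fin k)
    (hc : ∀ a b : G, a ≠ 0 → b ≠ 0 → a ≠ b → ¬ (c a = c b ∧ c a = c (a + b)))
    (C : Finset (Fin k)) (A : Finset G)
    (hA : ∀ x ∈ A, ∀ y ∈ A, x ≠ y → c (x + y) ∈ C) : A.card ≤ triangleBound C.card := by
  have hne : ∀ x y : G, x ≠ y → x + y ≠ 0 := fun x y hxy h =>
    hxy (add_right_cancel (h.trans (hG y).symm))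
  induction hn : C.card generalizing C A with
  | zero =>
    rw [Finset.card_eq_zero] at hn
    subst hn
    refine Finset.card_le_one.2 fun x hx y hy => ?_
    by_contra hxy
    exact absurd (hA x hx y hy hxy) (Finset.notMem_empty _)
  | succ n ih =>
    rcases A.eq_empty_or_nonempty with rfl | ⟨x, hx⟩
    · simp
    have hcard : (A.erase x).card ≤ triangleBound n * C.card := by
      refine Finset.card_le_mul_card_image_of_maps_to (f := fun y => c (x + y)) ?_ _ ?_
      · intro y hy
        rw [Finset.mem_erase] at hy
        exact hA x hx y hy.2 hy.1.symm
      · intro i hi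
        refine ih (C.erase i) _ ?_ (by rw [Finset.card_erase_of_mem hi, hn]; rfl)
        intro y hy z hz hyz
        simp only [Finset.mem_filter, Finset.mem_erase] at hy hz
        refine Finset.mem_erase.2 ⟨fun hi' => ?_, hA y hy.1.2 z hz.1.2 hyz⟩
        have hsum : (x + y) + (x + z) = y + z := by
          rw [add_add_add_comm, hG, zero_add]
        refine hc (x + y) (x + z) (hne _ _ hy.1.1.symm) (hne _ _ hz.1.1.symm)
          (fun h => hyz (add_left_cancel h)) ?_
        rw [hsum, hy.2, hz.2, hi']
        exact ⟨rfl, rfl⟩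
    rw [Finset.card_erase_of_mem hx, hn] at hcard
    rw [triangleBound]
    have := Nat.mul_comm (triangleBound n) (n + 1)
    omega

end Schur

/-! ### The projective triple system and its image under seventh powers -/

namespace SteinerTriple

open PreAbstractSimplicialComplex

/-- The permutation `x ↦ x ^ 7` of the units of a field with 128 elements. Its inverse is
`x ↦ x ^ 109`, since `7 * 109 = 6 * 127 + 1`. -/
def seventhPower {F : Type*} [Field F] [Fintype F] (hF : Fintype.card F = 128) : Equiv.Perm Fˣ where
  toFun x := x ^ 7
  invFun x := x ^ 109
  left_inv x := by
    change (x ^ 7) ^ 109 = x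
    rw [← pow_mul, pow_eq_pow_mod _ (unit_pow_eq_one hF x), pow_one]
  right_inv x := by
    change (x ^ 109) ^ 7 = x
    rw [← pow_mul, pow_eq_pow_mod _ (unit_pow_eq_one hF x), pow_one]

variable {F : Type*} [Field F] [DecidableEq F]

/-- In characteristic two, the projective triples are the 3-element sets of units with sum zero. -/
lemma mem_PG_iff [CharP F 2] {t : Finset Fˣ} : t ∈ PG F ↔ t.card = 3 ∧ ∑ x ∈ t, (x : F) = 0 := by
  constructor
  · rintro ⟨a, b, c, hab, hsum, rfl⟩
    have hac : a ≠ c := by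
      rintro rfl
      exact b.ne_zero (by linear_combination hsum - CharTwo.add_self_eq_zero (a : F))
    have hbc : b ≠ c := by
      rintro rfl
      exact a.ne_zero (by linear_combination hsum - CharTwo.add_self_eq_zero (b : F))
    refine ⟨Finset.card_eq_three.2 ⟨a, b, c, hab, hac, hbc, rfl⟩, ?_⟩
    rw [Finset.sum_insert (by simp [hab, hac]), Finset.sum_pair hbc, ← add_assoc, hsum]
  · rintro ⟨hcard, hsum⟩
    obtain ⟨a, b, c, hab, hac, hbc, rfl⟩ := Finset.card_eq_three.1 hcard
    rw [Finset.sum_insert (by simp [hab, hac]), Finset.sum_pair hbc, ← add_assoc] at hsum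
    exact ⟨a, b, c, hab, hsum, rfl⟩

lemma triple_mem_PG_iff [CharP F 2] {a b c : Fˣ} (hab : a ≠ b) (hac : a ≠ c) (hbc : b ≠ c) :
    {a, b, c} ∈ PG F ↔ (a : F) + b + c = 0 := by
  rw [mem_PG_iff, Finset.sum_insert (by simp [hab, hac]), Finset.sum_pair hbc, ← add_assoc]
  exact and_iff_right (Finset.card_eq_three.2 ⟨a, b, c, hab, hac, hbc, rfl⟩)

lemma triple_mem_image_iff {S : Set (Finset Fˣ)} (T : Equiv.Perm Fˣ) (a b c : Fˣ) :
    {a, b, c} ∈ image S T ↔ {T.symm a, T.symm b, T.symm c} ∈ S := by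
  have key : ∀ t : Finset Fˣ, t.map T.toEmbedding = {a, b, c} ↔
      t = {T.symm a, T.symm b, T.symm c} := by
    intro t
    rw [← Finset.map_inj (f := T.toEmbedding) (s₂ := {T.symm a, T.symm b, T.symm c})]
    simp
  exact ⟨fun ⟨t, ht, h⟩ => (key t).1 h ▸ ht, fun h => ⟨_, h, (key _).2 rfl⟩⟩

lemma isSteinerTripleSystem_PG [CharP F 2] : IsSteinerTripleSystem (PG F) where
  card_eq t ht := (mem_PG_iff.1 ht).1
  existsUnique x y hxy := by
    have hne : (x : F) + y ≠ 0 := fun h => hxy (Units.ext (CharTwo.add_eq_zero.1 h))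
    refine ⟨{x, y, Units.mk0 _ hne}, ⟨⟨x, y, _, hxy, ?_, rfl⟩, by simp, by simp⟩, ?_⟩
    · rw [Units.val_mk0, CharTwo.add_self_eq_zero]
    · rintro t ⟨ht, hx, hy⟩
      obtain ⟨hcard, hsum⟩ := mem_PG_iff.1 ht
      obtain ⟨z, hz⟩ : ∃ z, (t.erase x).erase y = {z} := by
        rw [← Finset.card_eq_one, Finset.card_erase_of_mem (by simp [hy, hxy.symm]),
          Finset.card_erase_of_mem hx, hcard]
      have ht' : t = {x, y, z} := by
        rw [← hz, Finset.insert_erase (by simp [hy, hxy.symm]), Finset.insert_erase hx]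
      have hzmem : z ∈ (t.erase x).erase y := by simp [hz]
      simp only [Finset.mem_erase] at hzmem
      rw [ht', Finset.sum_insert (by simp [hxy, hzmem.2.1.symm]),
        Finset.sum_pair hzmem.1.symm, ← add_assoc] at hsum
      have : z = Units.mk0 _ hne := Units.ext (CharTwo.add_eq_zero.1 hsum).symm
      rw [ht', this]

variable [Fintype F]

/-- The complex generated by the projective triples and their images under seventh powers. -/
abbrev seventhPowerComplex (hF : Fintype.card F = 128) : PreAbstractSimplicialComplex Fˣ :=
  unionComplex (PG F) (image (PG F) (seventhPower hF))

lemma card_units_eq (hF : Fintype.card F = 128) : Fintype.card Fˣ = 127 := by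
  rw [Fintype.card_units, hF]

section

variable (hF : Fintype.card F = 128)

lemma isSteinerTripleSystem_image_PG :
    IsSteinerTripleSystem (image (PG F) (seventhPower hF)) :=
  have := charP_two_of_card hF
  isSteinerTripleSystem_PG.image _

lemma triple_mem_seventhPowerComplex_iff {a b c : Fˣ} (hab : a ≠ b) (hac : a ≠ c) (hbc : b ≠ c) :
    {a, b, c} ∈ seventhPowerComplex hF ↔
      (a : F) + b + c = 0 ∨ (a : F) ^ 109 + b ^ 109 + c ^ 109 = 0 := by
  have := charP_two_of_card hF
  rw [mem_unionComplex_of_card_eq_three isSteinerTripleSystem_PG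
    (isSteinerTripleSystem_image_PG hF) (Finset.card_eq_three.2 ⟨a, b, c, hab, hac, hbc, rfl⟩),
    Set.mem_union, triple_mem_PG_iff hab hac hbc, triple_mem_image_iff,
    triple_mem_PG_iff (by simpa using hab) (by simpa using hac) (by simpa using hbc)]
  rfl

/-- With `z = x + y`, the sum `x ^ 7 + y ^ 7 + z ^ 7` is `x * y * z * (x ^ 2 + x * y + y ^ 2) ^ 2`,
and the last factor does not vanish because the group of units has no element of order 3. -/
lemma disjoint_PG_image : Disjoint (PG F) (image (PG F) (seventhPower hF)) := by
  have := charP_two_of_card hF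
  rw [Set.disjoint_left]
  rintro _ h ⟨t, ⟨x, y, z, hxy, hsum, rfl⟩, rfl⟩
  have ht : ({x, y, z} : Finset Fˣ).card = 3 := (mem_PG_iff.1 ⟨x, y, z, hxy, hsum, rfl⟩).1
  have h7 : (x : F) ^ 7 + y ^ 7 + z ^ 7 = 0 := by
    have h' := (mem_PG_iff.1 h).2
    rw [Finset.sum_map] at h'
    have hxz : x ≠ z := by
      rintro rfl
      exact y.ne_zero (by linear_combination hsum - CharTwo.add_self_eq_zero (x : F))
    have hyz : y ≠ z := by
      rintro rfl
      exact x.ne_zero (by linear_combination hsum - CharTwo.add_self_eq_zero (y : F))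
    rw [Finset.sum_insert (by simp [hxy, hxz]), Finset.sum_pair hyz, ← add_assoc] at h'
    simpa [seventhPower] using h'
  have hz : (z : F) = x + y := (CharTwo.add_eq_zero.1 hsum).symm
  have h2 : (2 : F) = 0 := CharTwo.two_eq_zero
  have hprod : (x : F) * y * z * (x ^ 2 + x * y + y ^ 2) ^ 2 = 0 := by
    rw [hz] at h7 ⊢
    linear_combination h7 -
      (x ^ 7 + y ^ 7 + 3 * (x * y * (x + y) * (x ^ 2 + x * y + y ^ 2) ^ 2)) * h2
  have hq : (x : F) ^ 2 + x * y + y ^ 2 = 0 := by simpa using hprod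
  have h3 : (x / y) ^ 3 = 1 := by
    rw [div_pow, div_eq_one]
    ext
    push_cast
    linear_combination ((x : F) - y) * hq
  have h1 : x / y = 1 := by
    have := unit_pow_eq_one hF (x / y)
    rwa [show 127 = 3 * 42 + 1 by norm_num, pow_succ, pow_mul, h3, one_pow, one_mul] at this
  exact hxy (div_eq_one.1 h1)

end

end SteinerTriple

/-! ### The vertex links -/

namespace SteinerTriple

open PreAbstractSimplicialComplex

/-- For a root `u` of `X ^ 7 + X + 1`, the link of the vertex `1` is the cycle of length 126 through
the vertices `u ^ linkExponent i`. The Frobenius map rotates this cycle: adding 18 to `i` multiplies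
the exponent by 16 modulo 127, so 18 exponents determine all of them. -/
def linkExponent (i : Fin 126) : ℕ :=
  2 ^ (4 * (i.val / 18)) * [1, 7, 49, 122, 63, 3, 38, 58, 86, 34, 66, 27, 75, 41, 99, 103, 26,
    110].getD (i.val % 18) 0 % 127

/-- The neighbor of the `i`-th vertex of the link along an edge from the projective system. -/
def projectiveMate (i : Fin 126) : Fin 126 := if i.val % 2 = 0 then i + 1 else i - 1

/-- The neighbor of the `i`-th vertex of the link along an edge from the image system. -/
def imageMate (i : Fin 126) : Fin 126 := if i.val % 2 = 0 then i - 1 else i + 1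

lemma eq_mate_iff (i j : Fin 126) :
    j = projectiveMate i ∨ j = imageMate i ↔ i - j = 1 ∨ j - i = 1 := by
  have h1 : j = i + 1 ↔ j - i = 1 := by rw [sub_eq_iff_eq_add, add_comm]
  have h2 : j = i - 1 ↔ i - j = 1 := by
    rw [eq_sub_iff_add_eq, sub_eq_iff_eq_add, add_comm, eq_comm]
  unfold projectiveMate imageMate
  split_ifs
  · rw [h1, h2, or_comm]
  · rw [h1, h2]

lemma linkExponent_injective : Function.Injective linkExponent := by
  have : ∀ i j, linkExponent i = linkExponent j → i = j := by decide +kernel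
  exact this

lemma linkExponent_ne_zero : ∀ i, linkExponent i ≠ 0 := by decide +kernel

lemma linkExponent_lt (i : Fin 126) : linkExponent i < 127 := Nat.mod_lt _ (by norm_num)

lemma reduceBits_projectiveMate : ∀ i, reduceBits 120
    (1 ^^^ 2 ^ linkExponent i ^^^ 2 ^ linkExponent (projectiveMate i)) = 0 := by
  decide +kernel

lemma reduceBits_imageMate : ∀ i, reduceBits 120
    (1 ^^^ 2 ^ (linkExponent i * 109 % 127) ^^^ 2 ^ (linkExponent (imageMate i) * 109 % 127)) =
      0 := by
  decide +kernel

section LinkPoint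

variable {F : Type*} [Field F] [Fintype F]

/-- The `i`-th vertex of the link of the vertex `1`. -/
def linkPoint {M : Type*} [Monoid M] (u : M) (i : Fin 126) : M := u ^ linkExponent i

variable {u : Fˣ}

lemma linkPoint_injective (hF : Fintype.card F = 128) (hu : (u : F) ^ 7 + u + 1 = 0) :
    Function.Injective (linkPoint u) := by
  intro i j hij
  have hord := orderOf_unit_root hF hu
  refine linkExponent_injective (pow_injOn_Iio_orderOf ?_ ?_ hij)
  · simpa [hord] using linkExponent_lt i
  · simpa [hord] using linkExponent_lt j

lemma linkPoint_ne_one (hF : Fintype.card F = 128) (hu : (u : F) ^ 7 + u + 1 = 0) (i : Fin 126) :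
    linkPoint u i ≠ 1 := by
  intro h
  have hdvd := orderOf_dvd_of_pow_eq_one h
  rw [orderOf_unit_root hF hu] at hdvd
  exact linkExponent_ne_zero i (Nat.eq_zero_of_dvd_of_lt hdvd (linkExponent_lt i))

lemma exists_linkPoint_eq (hF : Fintype.card F = 128) (hu : (u : F) ^ 7 + u + 1 = 0)
    {x : Fˣ} (hx : x ≠ 1) :
    ∃ i, linkPoint u i = x := by
  classical
  have himage : Finset.univ.image (linkPoint u) = Finset.univ.erase 1 := by
    refine Finset.eq_of_subset_of_card_le ?_ ?_
    · intro y hy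
      obtain ⟨i, -, rfl⟩ := Finset.mem_image.1 hy
      simpa using linkPoint_ne_one hF hu i
    · rw [Finset.card_image_of_injective _ (linkPoint_injective hF hu),
        Finset.card_erase_of_mem (Finset.mem_univ _), Finset.card_univ, card_units_eq hF]
      simp
  have hmem : x ∈ Finset.univ.image (linkPoint u) := by simp [himage, hx]
  simpa using hmem

lemma exists_mul_linkPoint_eq (hF : Fintype.card F = 128) (hu : (u : F) ^ 7 + u + 1 = 0)
    {v w : Fˣ} (hvw : v ≠ w) :
    ∃ i, v * linkPoint u i = w := by
  obtain ⟨i, hi⟩ := exists_linkPoint_eq hF hu (x := v⁻¹ * w) (by simpa [inv_mul_eq_one] using hvw)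
  exact ⟨i, by rw [hi, mul_inv_cancel_left]⟩

lemma one_add_linkPoint_add_eq_zero_iff (hF : Fintype.card F = 128)
    (hu : (u : F) ^ 7 + u + 1 = 0) (i j : Fin 126) :
    (1 : F) + linkPoint u i + linkPoint u j = 0 ↔ j = projectiveMate i := by
  have := charP_two_of_card hF
  have h : (1 : F) + linkPoint u i + linkPoint u (projectiveMate i) = 0 :=
    mod_cast one_add_pow_add_pow_eq_zero hu (reduceBits_projectiveMate i)
  refine ⟨fun hj => linkPoint_injective hF hu (Units.ext ?_), fun hj => hj ▸ h⟩
  linear_combination hj - h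

lemma one_add_linkPoint_pow_add_eq_zero_iff (hF : Fintype.card F = 128)
    (hu : (u : F) ^ 7 + u + 1 = 0) (i j : Fin 126) :
    (1 : F) + linkPoint u i ^ 109 + linkPoint u j ^ 109 = 0 ↔ j = imageMate i := by
  have := charP_two_of_card hF
  have hpow : ∀ k, (u ^ (linkExponent k * 109 % 127) : Fˣ) = linkPoint u k ^ 109 := fun k => by
    rw [← pow_eq_pow_mod _ (unit_pow_eq_one hF u), pow_mul]
    rfl
  have h : (1 : F) + linkPoint u i ^ 109 + linkPoint u (imageMate i) ^ 109 = 0 := by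
    have := one_add_pow_add_pow_eq_zero hu (reduceBits_imageMate i)
    rw [← Units.val_pow_eq_pow_val, ← Units.val_pow_eq_pow_val u, hpow, hpow] at this
    exact mod_cast this
  refine ⟨fun hj => linkPoint_injective hF hu ((seventhPower hF).symm.injective (Units.ext ?_)),
    fun hj => hj ▸ h⟩
  change ((linkPoint u j ^ 109 : Fˣ) : F) = (linkPoint u (imageMate i) ^ 109 : Fˣ)
  push_cast
  linear_combination hj - h

end LinkPoint

variable {F : Type*} [Field F] [DecidableEq F] [Fintype F] (hF : Fintype.card F = 128)

/-- The link of `v` is obtained from that of `1` by multiplication by `v`. -/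
lemma insert_linkPoint_mem_iff {u : Fˣ} (hu : (u : F) ^ 7 + u + 1 = 0) (v : Fˣ) {i j : Fin 126}
    (hij : i ≠ j) : {v, v * linkPoint u i, v * linkPoint u j} ∈ seventhPowerComplex hF ↔
      i - j = 1 ∨ j - i = 1 := by
  rw [triple_mem_seventhPowerComplex_iff, ← eq_mate_iff,
    ← one_add_linkPoint_add_eq_zero_iff hF hu, ← one_add_linkPoint_pow_add_eq_zero_iff hF hu]
  · push_cast
    refine or_congr ?_ ?_
    · rw [show (v : F) + v * linkPoint u i + v * linkPoint u j =
        v * (1 + linkPoint u i + linkPoint u j) by ring, mul_eq_zero, or_iff_right v.ne_zero]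
    · rw [show (v : F) ^ 109 + (v * linkPoint u i) ^ 109 + (v * linkPoint u j) ^ 109 =
        v ^ 109 * (1 + linkPoint u i ^ 109 + linkPoint u j ^ 109) by ring, mul_eq_zero,
        or_iff_right (pow_ne_zero 109 v.ne_zero)]
  · simpa using linkPoint_ne_one hF hu i
  · simpa using linkPoint_ne_one hF hu j
  · simpa using fun h => hij (linkPoint_injective hF hu h)

lemma mem_vertexSet_link_iff (v w : Fˣ) :
    w ∈ ((seventhPowerComplex hF).link v).vertexSet ↔ v ≠ w := by
  have := charP_two_of_card hF
  constructor
  · rintro ⟨-, hv, -⟩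
    simpa using hv
  · intro hvw
    exact ⟨Finset.singleton_nonempty w, by simpa using hvw,
      pair_mem_unionComplex isSteinerTripleSystem_PG hvw⟩

lemma link_isCycle (v : Fˣ) : ((seventhPowerComplex hF).link v).IsCycle := by
  have := charP_two_of_card hF
  obtain ⟨u, hu⟩ := exists_unit_root_of_card hF
  refine ⟨?_, 126, by norm_num, ?_⟩
  · rintro s ⟨-, hv, hs⟩
    have := card_le_three_of_mem_unionComplex isSteinerTripleSystem_PG
      (isSteinerTripleSystem_image_PG hF) hs
    rw [Finset.card_insert_of_notMem hv] at this
    omega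
  let f : Fin 126 → ((seventhPowerComplex hF).link v).vertexSet := fun i =>
    ⟨v * linkPoint u i, (mem_vertexSet_link_iff hF v _).2
      (by simpa using linkPoint_ne_one hF hu i)⟩
  have hf : Function.Bijective f := by
    refine ⟨fun i j hij => linkPoint_injective hF hu ?_, fun ⟨w, hw⟩ => ?_⟩
    · simpa [f] using hij
    · obtain ⟨i, hi⟩ := exists_mul_linkPoint_eq hF hu ((mem_vertexSet_link_iff hF v w).1 hw)
      exact ⟨i, Subtype.ext hi⟩
  refine ⟨RelIso.symm ⟨Equiv.ofBijective f hf, ?_⟩⟩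
  intro i j
  rw [SimpleGraph.cycleGraph_adj]
  change f i ≠ f j ∧ ({v * linkPoint u i, v * linkPoint u j} : Finset Fˣ) ∈
    (seventhPowerComplex hF).link v ↔ _
  rw [hf.1.ne_iff]
  constructor
  · rintro ⟨hij, -, -, hmem⟩
    exact (insert_linkPoint_mem_iff hF hu v hij).1 hmem
  · intro hij
    have hne : i ≠ j := by
      rintro rfl
      simp at hij
    refine ⟨hne, by simp, ?_, (insert_linkPoint_mem_iff hF hu v hne).2 hij⟩
    simp [linkPoint_ne_one hF hu]

lemma isTransversal_seventhPower : IsTransversal (PG F) (seventhPower hF) :=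
  have := charP_two_of_card hF
  have := nontrivial_units hF
  { left := isSteinerTripleSystem_PG
    right := isSteinerTripleSystem_image_PG hF
    disjoint := disjoint_PG_image hF
    vertexSet_eq := vertexSet_unionComplex isSteinerTripleSystem_PG
    isCombinatorialSurface :=
      { finite := Set.toFinite _
        connected := oneSkeleton_unionComplex_connected isSteinerTripleSystem_PG
        link_isCycle := fun v _ => link_isCycle hF v } }

/-! ### Non-orientability -/

/-- An orientation of all triangles orients each vertex link. The link of `v * u`, traversed as the
translate of the link of `v`, passes through the common edge of the two links in the opposite
sense, so multiplication by `u` reverses the orientation of the links; this is impossible as `u`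
has odd order. -/
lemma not_isOrientable : ¬ (seventhPowerComplex hF).IsOrientable := by
  rintro ⟨o, hrot, hxor, hedge⟩
  obtain ⟨u, hu⟩ := exists_unit_root_of_card hF
  have htri : ∀ v i, (seventhPowerComplex hF).IsTriangle v (v * linkPoint u i)
      (v * linkPoint u (i + 1)) := by
    intro v i
    have hi : i ≠ i + 1 := by simp
    refine ⟨?_, ?_, ?_, (insert_linkPoint_mem_iff hF hu v hi).2 (by simp)⟩
    · simpa using linkPoint_ne_one hF hu i
    · simpa using fun h => hi (linkPoint_injective hF hu h)
    · simpa using linkPoint_ne_one hF hu (i + 1)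
  have hflip : ∀ {a b c}, (seventhPowerComplex hF).IsTriangle a b c →
      (seventhPowerComplex hF).IsTriangle b a c ∧ (seventhPowerComplex hF).IsTriangle a c b := by
    rintro a b c ⟨hab, hbc, hac, hmem⟩
    refine ⟨⟨hab.symm, hac, hbc, by rwa [Finset.insert_comm]⟩, ⟨hac, hbc.symm, hab, ?_⟩⟩
    rwa [Finset.pair_comm c b]
  have hstep : ∀ v i, o v (v * linkPoint u i) (v * linkPoint u (i + 1)) ↔
      o v (v * linkPoint u (i + 1)) (v * linkPoint u (i + 1 + 1)) := by
    intro v i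
    have hne : v * linkPoint u (i + 1 + 1) ≠ v * linkPoint u i := by
      intro h
      have : i + 1 + 1 = i := linkPoint_injective hF hu (mul_left_cancel h)
      rw [add_assoc, add_eq_left] at this
      exact absurd this (by decide)
    rw [hedge v (v * linkPoint u (i + 1)) (v * linkPoint u (i + 1 + 1)) (v * linkPoint u i)
      (htri v (i + 1)) (hflip (htri v i)).2 hne]
    exact ⟨fun h => hrot _ _ _ (hrot _ _ _ h), hrot _ _ _⟩
  have hall : ∀ v i, o v (v * linkPoint u 0) (v * linkPoint u (0 + 1)) ↔
      o v (v * linkPoint u i) (v * linkPoint u (i + 1)) := by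
    intro v i
    induction i using Fin.induction with
    | zero => rfl
    | succ i ih => rw [ih, hstep, Fin.coeSucc_eq_succ]
  -- The exponents at positions 0, 1, 40, 41 are 1, 7, 126, 6; so the edge from position 40 to
  -- position 41 in the link of `v * u` lies in the triangle `{v, v * u, v * u ^ 7}`.
  have hreverse : ∀ v : Fˣ,
      o (v * u) (v * u * linkPoint u 0) (v * u * linkPoint u (0 + 1)) ↔
        ¬ o v (v * linkPoint u 0) (v * linkPoint u (0 + 1)) := by
    intro v
    have h0 : linkPoint u 0 = u := pow_one u
    have h1 : v * u * linkPoint u 40 = v := by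
      change v * u * u ^ 126 = v
      rw [mul_assoc, ← pow_succ', unit_pow_eq_one hF u, mul_one]
    have h2 : v * u * linkPoint u (40 + 1) = v * linkPoint u (0 + 1) := by
      change v * u * u ^ 6 = v * u ^ 7
      rw [mul_assoc, ← pow_succ']
    rw [hall (v * u) 40, h1, h2, h0]
    have := hxor _ _ _ (htri v 0)
    rw [h0] at this
    exact xor_iff_iff_not.1 (xor_comm _ _ ▸ this)
  have hpow : ∀ n : ℕ, o (u ^ n) (u ^ n * linkPoint u 0) (u ^ n * linkPoint u (0 + 1)) ↔
      (Even n ↔ o 1 (1 * linkPoint u 0) (1 * linkPoint u (0 + 1))) := by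
    intro n
    induction n with
    | zero => simp
    | succ n ih => rw [pow_succ, hreverse, ih, Nat.even_add_one]; tauto
  have := hpow 127
  rw [unit_pow_eq_one hF u] at this
  have h127 : ¬ Even 127 := by decide
  tauto

/-! ### The 2-chromatic number -/

/-- A coloring of the exponents modulo 127 with 6 colors, the color of `j` being the `j`-th decimal
digit, counted from the right, of the number below. -/
def exponentColor (j : ℕ) : Fin 6 :=
  Fin.ofNat 6
    (((511251240242125341121545230421440230434420144044140442212431115 * 10 ^ 64 +
      1314322044501241245433102424441031112552122441232534122501102504) /
        10 ^ (j % 127)) % 10)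

lemma exponentColor_mod (j : ℕ) : exponentColor (j % 127) = exponentColor j := by
  simp [exponentColor]

lemma exponentColor_not_monochromatic : ∀ (i : Fin 126) (j : Fin 127),
    ¬ (exponentColor (j + linkExponent i) = exponentColor j ∧
      exponentColor (j + linkExponent (i + 1)) = exponentColor j) := by
  decide +kernel

lemma isColorable_six : (seventhPowerComplex hF).IsColorable 6 2 := by
  obtain ⟨u, hu⟩ := exists_unit_root_of_card hF
  choose log hlog using exists_pow_unit_root_eq hF hu
  have hcolor : ∀ n, exponentColor (log (u ^ n)) = exponentColor n := by
    intro n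
    have h := pow_inj_mod.1 (hlog (u ^ n))
    rw [orderOf_unit_root hF hu] at h
    rw [← exponentColor_mod, h, exponentColor_mod]
  -- The three vertices of a triangle are `v` and two consecutive vertices of its link.
  have hmono : ∀ (v : Fˣ) (i : Fin 126),
      ¬ (exponentColor (log (v * linkPoint u i)) = exponentColor (log v) ∧
        exponentColor (log (v * linkPoint u (i + 1))) = exponentColor (log v)) := by
    intro v i
    have hshift : ∀ k, exponentColor (log (v * linkPoint u k)) =
        exponentColor (log v % 127 + linkExponent k) := by
      intro k
      rw [← hlog v, linkPoint, ← pow_add, hcolor, hlog, ← exponentColor_mod,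
        ← exponentColor_mod (log v % 127 + _), Nat.mod_add_mod]
    rw [hshift, hshift, ← exponentColor_mod (log v)]
    exact exponentColor_not_monochromatic i ⟨log v % 127, Nat.mod_lt _ (by norm_num)⟩
  refine ⟨fun v => exponentColor (log v), ?_⟩
  rintro t ht hcard ⟨k, hk⟩
  have hk' : ∀ v ∈ t, exponentColor (log v) = k := by
    intro v hv
    have := charP_two_of_card hF
    have := nontrivial_units hF
    exact hk ⟨v, singleton_mem_unionComplex isSteinerTripleSystem_PG v⟩ hv
  obtain ⟨a, b, c, hab, hac, hbc, rfl⟩ := Finset.card_eq_three.1 hcard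
  obtain ⟨i, rfl⟩ := exists_mul_linkPoint_eq hF hu hab
  obtain ⟨j, rfl⟩ := exists_mul_linkPoint_eq hF hu hac
  have hij : i ≠ j := by
    rintro rfl
    exact hbc rfl
  have ha := hk' a (by simp)
  have hb := hk' (a * linkPoint u i) (by simp)
  have hc := hk' (a * linkPoint u j) (by simp)
  rcases (insert_linkPoint_mem_iff hF hu a hij).1 ht with h | h
  · rw [sub_eq_iff_eq_add'] at h
    subst h
    exact hmono a j ⟨hc.trans ha.symm, hb.trans ha.symm⟩
  · rw [sub_eq_iff_eq_add'] at h
    subst h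
    exact hmono a i ⟨hb.trans ha.symm, hc.trans ha.symm⟩

/-- Already the projective triples force 5 colors, as `128 > triangleBound 4 = 65`. -/
lemma not_isColorable_of_le_four {k : ℕ} (hk : k ≤ 4) :
    ¬ (seventhPowerComplex hF).IsColorable k 2 := by
  rintro ⟨c, hc⟩
  have := charP_two_of_card hF
  have := nontrivial_units hF
  have hvert : ∀ x, x ∈ (seventhPowerComplex hF).vertexSet :=
    singleton_mem_unionComplex isSteinerTripleSystem_PG
  let c' : F → Fin k := fun x =>
    if hx : x = 0 then c ⟨1, hvert 1⟩ else c ⟨Units.mk0 x hx, hvert _⟩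
  have hbound := card_le_triangleBound (fun x : F => CharTwo.add_self_eq_zero x) c' ?_
    Finset.univ Finset.univ (fun _ _ _ _ _ => Finset.mem_univ _)
  · rw [Finset.card_univ, Finset.card_univ, hF, Fintype.card_fin] at hbound
    have : triangleBound k ≤ 65 := by
      interval_cases k <;> decide
    omega
  · rintro a b ha hb hab ⟨h1, h2⟩
    have hsum : a + b ≠ 0 := fun h => hab (CharTwo.add_eq_zero.1 h)
    simp only [c', dif_neg ha, dif_neg hb, dif_neg hsum] at h1 h2
    have hmem : ({Units.mk0 a ha, Units.mk0 b hb, Units.mk0 _ hsum} : Finset Fˣ) ∈ PG F :=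
      ⟨_, _, _, by simpa [Units.ext_iff] using hab, CharTwo.add_self_eq_zero (a + b), rfl⟩
    have hcard := isSteinerTripleSystem_PG.card_eq _ hmem
    refine hc _ ⟨by simp, _, Or.inl hmem, subset_rfl⟩ hcard ⟨c ⟨Units.mk0 a ha, hvert _⟩, ?_⟩
    rintro ⟨v, hv⟩ hvt
    simp only [Finset.mem_insert, Finset.mem_singleton] at hvt
    rcases hvt with rfl | rfl | rfl
    · rfl
    · exact h1.symm
    · exact h2.symm

lemma chromaticNumber_eq_five_or_six :
    (seventhPowerComplex hF).chromaticNumber 2 = 5 ∨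
      (seventhPowerComplex hF).chromaticNumber 2 = 6 := by
  have hle : (seventhPowerComplex hF).chromaticNumber 2 ≤ 6 := iInf₂_le 6 (isColorable_six hF)
  have hge : 5 ≤ (seventhPowerComplex hF).chromaticNumber 2 := by
    refine le_iInf₂ fun k hk => ?_
    by_contra! hlt
    have hk4 : k < 5 := mod_cast hlt
    exact not_isColorable_of_le_four hF (by omega) hk
  lift (seventhPowerComplex hF).chromaticNumber 2 to ℕ using
    ne_top_of_le_ne_top (by decide) hle with n
  norm_cast at hle hge ⊢
  omega

end SteinerTriple

open SteinerTriple in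
theorem mainTheorem4 (F : Type*) [Field F] [Fintype F] [DecidableEq F]
    (hF : Fintype.card F = 128) :
    ∃ P₇ : Equiv.Perm Fˣ, (∀ x : Fˣ, P₇ x = x ^ 7) ∧
      SteinerTriple.IsTransversal (SteinerTriple.PG F) P₇ ∧
      let K := SteinerTriple.unionComplex (SteinerTriple.PG F)
        (SteinerTriple.image (SteinerTriple.PG F) P₇)
      K.IsNonorientableOfGenus 2542 ∧
      K.vertexSet.ncard = 127 ∧
      (K.faceCount 0 = 127 ∧ K.faceCount 1 = 8001 ∧ K.faceCount 2 = 5334 ∧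
        ∀ i, 3 ≤ i → K.faceCount i = 0) ∧
      (K.chromaticNumber 2 = 5 ∨ K.chromaticNumber 2 = 6) := by
  have hV := card_units_eq hF
  have := nontrivial_units hF
  have hT := isTransversal_seventhPower hF
  have h0 : (seventhPowerComplex hF).faceCount 0 = _ := faceCount_zero_unionComplex hT.left
  have h1 : (seventhPowerComplex hF).faceCount 1 = _ := faceCount_one_unionComplex hT.left
  have h2 : 3 * (seventhPowerComplex hF).faceCount 2 = _ :=
    faceCount_two_unionComplex hT.left hT.right hT.disjoint
  have hχ := eulerCharacteristic_unionComplex hT.left hT.right (by omega)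
  have hchoose : Nat.choose 127 2 = 8001 := by rw [Nat.choose_two_right]
  rw [hV] at h0
  rw [hV, hchoose] at h1 h2
  replace h2 : (seventhPowerComplex hF).faceCount 2 = 5334 := by omega
  refine ⟨seventhPower hF, fun _ => rfl, hT, ⟨hT.isCombinatorialSurface, not_isOrientable hF, ?_⟩,
    ?_, ⟨h0, h1, h2, fun i => faceCount_unionComplex_of_three_le hT.left hT.right⟩,
    chromaticNumber_eq_five_or_six hF⟩
  · rw [hχ, h0, h1, h2]
    norm_num
  · rw [hT.vertexSet_eq, Set.ncard_univ, Nat.card_eq_fintype_card, hV]
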